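/- Let $\Bbbk$ be a field. For a coalgebra $C$ over $\Bbbk$ (coassociative and counital), $\mathcal M^C$ denotes the category of right $C$-comodules and colinear maps, and $\mathcal M^C_f$ its full subcategory of finite-dimensional comodules. A morphism of coalgebras $\pi:H\to H'$ turns every $H$-comodule $V$, with coaction $v\mapsto v_0\otimes v_1$, into an $H'$-comodule with coaction $v\mapsto v_0\otimes\pi(v_1)$; this defines the corestriction functors $\mathcal M^H\to\mathcal M^{H'}$ and $\mathcal M^H_f\to\mathcal M^{H'}_f$, which are the identity on underlying linear maps. For a morphism $\pi:H\to H'$ of $\Bbbk$-coalgebras the following conditions are equivalent: (a) $\pi$ is a monomorphism in the category of $\Bbbk$-coalgebras; (b) the corestriction functor $\mathcal M^H\to\mathcal M^{H'}$ is full; (b$_f$) the corestriction functor $\mathcal M^H_f\to\mathcal M^{H'}_f$ is full; (c) for every $H$-comodule $V$, every idempotent $H'$-comodule endomorphism of $V$ is a morphism of $H$-comodules; (c$_f$) the same as (c) for every finite-dimensional $H$-comodule $V$; (d) for every $H$-comodule $V$, whenever $V=V_1\oplus V_2$ with $V_1,V_2$ being $H'$-subcomodules of $V$, both $V_1$ and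 $V_2$ are $H$-subcomodules of $V$; (d$_f$) the same as (d) for every finite-dimensional $H$-comodule $V$. If moreover $H$ and $H'$ are Hopf algebras and $\pi$ is a morphism of Hopf algebras, then all of these are also equivalent to each of the following: (e) for every right $H$-comodule $V$, the space $V^{H'}:=\{v\in V\mid v_0\otimes\pi(v_1)=v\otimes 1\}$ of $H'$-coinvariants equals the space $V^{H}:=\{v\in V\mid v_0\otimes v_1=v\otimes 1\}$ of $H$-coinvariants; (e$_f$) the same as (e) for every finite-dimensional right $H$-comodule $V$; (f) $H^{H'}=\Bbbk 1$, where $H$ is a right $H$-comodule through its comultiplication; that is, the only $h\in H$ with $h_1\otimes\pi(h_2)=h\otimes 1$ are the scalars. -/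

import Mathlib

open scoped TensorProduct
open CategoryTheory

universe u

/-- A right comodule over the `k`-coalgebra `C`: a `k`-vector space `V` with a coassociative and
counital coaction `V → V ⊗ C`. -/
structure Comod (k : Type u) [Field k] (C : Type u) [AddCommGroup C] [Module k C]
    [Coalgebra k C] where
  carrier : Type u
  [instAddCommGroup : AddCommGroup carrier]
  [instModule : Module k carrier]
  /-- The coaction `v ↦ v₀ ⊗ v₁`. -/
  coact : carrier →ₗ[k] carrier ⊗[k] C
  coassoc : TensorProduct.assoc k carrier C C ∘ₗ coact.rTensor C ∘ₗ coact =
    (Coalgebra.comul (R := k) (A := C)).lTensor carrier ∘ₗ coact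
  counital : (Coalgebra.counit (R := k) (A := C)).lTensor carrier ∘ₗ coact =
    (TensorProduct.mk k carrier k).flip 1

namespace Comod

attribute [instance] Comod.instAddCommGroup Comod.instModule

section Basic

variable {k : Type u} [Field k] {C : Type u} [AddCommGroup C] [Module k C] [Coalgebra k C]

instance : CoeSort (Comod k C) (Type u) := ⟨Comod.carrier⟩

/-- Morphisms of right comodules: the colinear maps. -/
@[ext]
structure Hom (V W : Comod k C) where
  toLinearMap : V →ₗ[k] W
  colinear : W.coact ∘ₗ toLinearMap = toLinearMap.rTensor C ∘ₗ V.coact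

/-- The category of right `C`-comodules. -/
instance category : Category (Comod k C) where
  Hom V W := Hom V W
  id V := ⟨LinearMap.id, by simp⟩
  comp f g := ⟨g.toLinearMap ∘ₗ f.toLinearMap, by
    rw [← LinearMap.comp_assoc, g.colinear, LinearMap.comp_assoc, f.colinear,
      ← LinearMap.comp_assoc, ← LinearMap.rTensor_comp]⟩

/-- A subspace `U` of a comodule `V` is a subcomodule if the coaction maps it to
`U ⊗ C ⊆ V ⊗ C`. -/
def IsSubcomodule (V : Comod k C) (U : Submodule k V) : Prop :=
  ∀ x ∈ U, V.coact x ∈ LinearMap.range (U.subtype.rTensor C)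

variable (k C) in
/-- The property of a comodule of being finite-dimensional over `k`. -/
def finDim : ObjectProperty (Comod k C) := fun V => FiniteDimensional k V

variable (k C) in
/-- The coalgebra `C` as a right comodule over itself, through its comultiplication. -/
abbrev regular : Comod k C where
  carrier := C
  coact := Coalgebra.comul
  coassoc := Coalgebra.coassoc
  counital := Coalgebra.lTensor_counit_comp_comul

end Basic

section Corestriction

variable {k : Type u} [Field k] {H H' : Type u} [AddCommGroup H] [Module k H] [Coalgebra k H]
  [AddCommGroup H'] [Module k H'] [Coalgebra k H']

/-- The `H'`-comodule obtained from an `H`-comodule `V` along a coalgebra morphism `π : H → H'`: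
the same space with the coaction `v ↦ v₀ ⊗ π(v₁)`. -/
abbrev corestrict (π : H →ₗc[k] H') (V : Comod k H) : Comod k H' where
  carrier := V
  coact := π.toLinearMap.lTensor V ∘ₗ V.coact
  coassoc := by
    have h1 : (π.toLinearMap.lTensor V ∘ₗ V.coact).rTensor H' ∘ₗ π.toLinearMap.lTensor V =
        TensorProduct.map (π.toLinearMap.lTensor V) π.toLinearMap ∘ₗ V.coact.rTensor H := by
      ext x y; simp
    have h2 : (TensorProduct.assoc k V H' H').toLinearMap ∘ₗ
          TensorProduct.map (π.toLinearMap.lTensor V) π.toLinearMap =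
        (TensorProduct.map π.toLinearMap π.toLinearMap).lTensor V ∘ₗ
          (TensorProduct.assoc k V H H).toLinearMap := by
      ext x y z; simp
    calc (TensorProduct.assoc k V H' H').toLinearMap ∘ₗ
          (π.toLinearMap.lTensor V ∘ₗ V.coact).rTensor H' ∘ₗ π.toLinearMap.lTensor V ∘ₗ V.coact
        = ((TensorProduct.assoc k V H' H').toLinearMap ∘ₗ
          ((π.toLinearMap.lTensor V ∘ₗ V.coact).rTensor H' ∘ₗ π.toLinearMap.lTensor V)) ∘ₗ
            V.coact := rfl
      _ = (((TensorProduct.assoc k V H' H').toLinearMap ∘ₗ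
          TensorProduct.map (π.toLinearMap.lTensor V) π.toLinearMap) ∘ₗ V.coact.rTensor H) ∘ₗ
            V.coact := by rw [h1]; rfl
      _ = (TensorProduct.map π.toLinearMap π.toLinearMap).lTensor V ∘ₗ
          ((TensorProduct.assoc k V H H).toLinearMap ∘ₗ V.coact.rTensor H ∘ₗ V.coact) := by
            rw [h2]; rfl
      _ = (TensorProduct.map π.toLinearMap π.toLinearMap ∘ₗ Coalgebra.comul).lTensor V ∘ₗ
            V.coact := by
            rw [V.coassoc, ← LinearMap.comp_assoc, ← LinearMap.lTensor_comp]
      _ = (Coalgebra.comul.lTensor V) ∘ₗ π.toLinearMap.lTensor V ∘ₗ V.coact := by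
            rw [π.map_comp_comul, LinearMap.lTensor_comp, LinearMap.comp_assoc]
  counital := by
    rw [← LinearMap.comp_assoc, ← LinearMap.lTensor_comp, π.counit_comp, V.counital]

/-- The corestriction functor induced by a coalgebra morphism; it is the identity on maps. -/
def corestriction (π : H →ₗc[k] H') : Comod k H ⥤ Comod k H' where
  obj V := corestrict π V
  map {V W} f := ⟨f.toLinearMap, by
    have h : f.toLinearMap.rTensor H' ∘ₗ π.toLinearMap.lTensor V =
        π.toLinearMap.lTensor W ∘ₗ f.toLinearMap.rTensor H := by
      ext x y; simp
    calc (π.toLinearMap.lTensor W ∘ₗ W.coact) ∘ₗ f.toLinearMap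
        = π.toLinearMap.lTensor W ∘ₗ (f.toLinearMap.rTensor H ∘ₗ V.coact) := by
          rw [LinearMap.comp_assoc, f.colinear]
      _ = f.toLinearMap.rTensor H' ∘ₗ (π.toLinearMap.lTensor V ∘ₗ V.coact) := by
          rw [← LinearMap.comp_assoc, ← h, LinearMap.comp_assoc]⟩

/-- The corestriction functor between the categories of finite-dimensional comodules. -/
def corestrictionFin (π : H →ₗc[k] H') :
    (finDim k H).FullSubcategory ⥤ (finDim k H').FullSubcategory :=
  (finDim k H').lift ((finDim k H).ι ⋙ corestriction π) (fun V => V.property)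

/-- Every idempotent `H'`-comodule endomorphism of the `H`-comodule `V` is a morphism of
`H`-comodules. -/
def IdempotentsLift (π : H →ₗc[k] H') (V : Comod k H) : Prop :=
  ∀ e : (corestriction π).obj V ⟶ (corestriction π).obj V, e ≫ e = e →
    ∃ e' : V ⟶ V, (corestriction π).map e' = e

/-- Every decomposition of the `H`-comodule `V` as an internal direct sum of two
`H'`-subcomodules is one into `H`-subcomodules. -/
def DecompositionsLift (π : H →ₗc[k] H') (V : Comod k H) : Prop :=
  ∀ V₁ V₂ : Submodule k V, IsCompl V₁ V₂ →
    (corestrict π V).IsSubcomodule V₁ → (corestrict π V).IsSubcomodule V₂ →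
    V.IsSubcomodule V₁ ∧ V.IsSubcomodule V₂

end Corestriction

section Coinvariants

variable {k : Type u} [Field k] {H : Type u} [Ring H] [Bialgebra k H]

/-- The coinvariants `{v | v₀ ⊗ v₁ = v ⊗ 1}` of a right comodule over a bialgebra. -/
def coinvariants (V : Comod k H) : Submodule k V :=
  LinearMap.eqLocus V.coact ((TensorProduct.mk k V H).flip 1)

end Coinvariants

end Comod

/-!
A right `C`-comodule is a module over the dual algebra `C*`, and functionals on `C` separate the
elements of `V ⊗ C`, so colinear maps are the `C*`-linear maps and subcomodules are the `C*`-stable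
subspaces. In particular the subcomodule `C* v` generated by a vector `v` is finite-dimensional,
which reduces statements about all comodules to finite-dimensional ones, and an idempotent is
colinear exactly when its range and kernel are subcomodules.

A linear map `f : V → W` is colinear when the idempotent `(v, w) ↦ (v, f v)` of `V × W` is, so
lifting idempotents already gives fullness. It is also colinear when the automorphism
`(v, w) ↦ (v, w + f v)` is. An automorphism of a finite-dimensional comodule transports its matrix
coefficients, and colinearity says that the old and the new coefficients coincide. Both families are
coalgebra morphisms from a comatrix coalgebra to `H`, so if `π` is a monomorphism it suffices to
compare them after composing with `π`. Conversely, if `π f = π g` for `f, g : C → H`, the identity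
of `C` is `H'`-colinear between the comodules obtained from `C` along `f` and `g`; by fullness it is
`H`-colinear, and the counit yields `f = g`.

For Hopf algebras, `π f = π g` makes the convolution product `f * (S ∘ g)` take values in the
`H'`-coinvariants of `H`. If these are the scalars, then `f * (S ∘ g)` is trivial and `f = g`.
-/

section Slice

variable {R M N P C D : Type*} [CommSemiring R] [AddCommMonoid M] [Module R M]
  [AddCommMonoid N] [Module R N] [AddCommMonoid C] [Module R C] [AddCommMonoid D] [Module R D]

/-- The slice map `m ⊗ c ↦ φ(c) m` given by a functional `φ` on the right tensor factor. -/
noncomputable def rightSlice : Module.Dual R C →ₗ[R] M ⊗[R] C →ₗ[R] M :=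
  (TensorProduct.rid R M).toLinearMap.compRight R ∘ₗ LinearMap.lTensorHom M

@[simp]
theorem rightSlice_tmul (φ : Module.Dual R C) (m : M) (c : C) :
    rightSlice φ (m ⊗ₜ[R] c) = φ c • m := by
  simp [rightSlice]

theorem rightSlice_rTensor (φ : Module.Dual R C) (f : M →ₗ[R] N) (t : M ⊗[R] C) :
    rightSlice φ (f.rTensor C t) = f (rightSlice φ t) := by
  induction t <;> simp_all

theorem rightSlice_lTensor (φ : Module.Dual R D) (g : C →ₗ[R] D) (t : M ⊗[R] C) :
    rightSlice φ (g.lTensor M t) = rightSlice (φ ∘ₗ g) t := by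
  induction t <;> simp_all

theorem rightSlice_rightSlice (ψ : Module.Dual R C) (φ : Module.Dual R D)
    (t : (M ⊗[R] C) ⊗[R] D) :
    rightSlice ψ (rightSlice φ t) =
      rightSlice (LinearMap.mul' R R ∘ₗ TensorProduct.map ψ φ) (TensorProduct.assoc R M C D t) := by
  have h : rightSlice ψ ∘ₗ rightSlice φ =
      rightSlice (M := M) (LinearMap.mul' R R ∘ₗ TensorProduct.map ψ φ) ∘ₗ
        (TensorProduct.assoc R M C D).toLinearMap := by
    ext m c d
    simpa [mul_smul] using smul_comm (φ d) (ψ c) m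
  exact LinearMap.congr_fun h t

theorem rightSlice_ext [Module.Free R C] {s t : M ⊗[R] C}
    (h : ∀ φ : Module.Dual R C, rightSlice φ s = rightSlice φ t) : s = t := by
  classical
  let b := Module.Free.chooseBasis R C
  apply (TensorProduct.equivFinsuppOfBasisRight b).injective
  ext i
  rw [TensorProduct.equivFinsuppOfBasisRight_apply, TensorProduct.equivFinsuppOfBasisRight_apply]
  exact h (b.coord i)

end Slice

theorem mem_range_rTensor_subtype_iff {R M C : Type*} [CommRing R] [AddCommGroup M] [Module R M]
    [AddCommGroup C] [Module R C] [Module.Free R C] {U : Submodule R M} {t : M ⊗[R] C} :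
    t ∈ LinearMap.range (U.subtype.rTensor C) ↔ ∀ φ : Module.Dual R C, rightSlice φ t ∈ U := by
  constructor
  · rintro ⟨s, rfl⟩ φ
    rw [rightSlice_rTensor]
    exact (rightSlice φ s).2
  · intro h
    rw [← rTensor_mkQ, LinearMap.mem_ker]
    refine rightSlice_ext fun φ => ?_
    rw [rightSlice_rTensor, map_zero]
    exact (Submodule.Quotient.mk_eq_zero U).2 (h φ)

namespace Comod

section Coaction

variable {R M N C D : Type*} [CommSemiring R] [AddCommMonoid M] [Module R M]
  [AddCommMonoid N] [Module R N] [AddCommMonoid C] [Module R C] [AddCommMonoid D] [Module R D]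
  {ρ : M →ₗ[R] M ⊗[R] C} {σ : N →ₗ[R] N ⊗[R] C} {i : M →ₗ[R] N}

theorem assoc_rTensor_coact_comp (h : σ ∘ₗ i = i.rTensor C ∘ₗ ρ) :
    (TensorProduct.assoc R N C C ∘ₗ σ.rTensor C ∘ₗ σ) ∘ₗ i =
      i.rTensor (C ⊗[R] C) ∘ₗ TensorProduct.assoc R M C C ∘ₗ ρ.rTensor C ∘ₗ ρ := by
  have assoc_natural : (TensorProduct.assoc R N C C).toLinearMap ∘ₗ (i.rTensor C).rTensor C =
      i.rTensor (C ⊗[R] C) ∘ₗ (TensorProduct.assoc R M C C).toLinearMap := by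
    ext; simp
  calc ((TensorProduct.assoc R N C C).toLinearMap ∘ₗ σ.rTensor C ∘ₗ σ) ∘ₗ i
      = (TensorProduct.assoc R N C C).toLinearMap ∘ₗ (σ ∘ₗ i).rTensor C ∘ₗ ρ := by
        rw [LinearMap.rTensor_comp, LinearMap.comp_assoc, LinearMap.comp_assoc,
          LinearMap.comp_assoc, h]
    _ = ((TensorProduct.assoc R N C C).toLinearMap ∘ₗ (i.rTensor C).rTensor C) ∘ₗ
          ρ.rTensor C ∘ₗ ρ := by
        rw [h, LinearMap.rTensor_comp, LinearMap.comp_assoc, LinearMap.comp_assoc]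
    _ = _ := by rw [assoc_natural, LinearMap.comp_assoc]

theorem lTensor_coact_comp (g : C →ₗ[R] D) (h : σ ∘ₗ i = i.rTensor C ∘ₗ ρ) :
    (g.lTensor N ∘ₗ σ) ∘ₗ i = i.rTensor D ∘ₗ g.lTensor M ∘ₗ ρ := by
  rw [LinearMap.comp_assoc, h, ← LinearMap.comp_assoc, ← LinearMap.comp_assoc,
    LinearMap.lTensor_comp_rTensor, LinearMap.rTensor_comp_lTensor]

end Coaction

section Colinear

open WithConv

variable {k : Type u} [Field k] {C : Type u} [AddCommGroup C] [Module k C] [Coalgebra k C]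
  {U V W : Comod k C}

/-- The left action `φ • v = φ(v₁) v₀` of the dual algebra of `C` on a right `C`-comodule. -/
noncomputable def dualAct (V : Comod k C) : Module.Dual k C →ₗ[k] Module.End k V :=
  LinearMap.lcomp k V V.coact ∘ₗ rightSlice

theorem dualAct_apply (V : Comod k C) (φ : Module.Dual k C) (v : V) :
    V.dualAct φ v = rightSlice φ (V.coact v) :=
  rfl

theorem dualAct_counit (V : Comod k C) : V.dualAct Coalgebra.counit = LinearMap.id := by
  ext v
  have h := congrArg (TensorProduct.rid k V) (LinearMap.congr_fun V.counital v)
  rwa [LinearMap.flip_apply, TensorProduct.mk_apply, TensorProduct.rid_tmul, one_smul] at h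

theorem dualAct_comp_dualAct (V : Comod k C) (ψ φ : Module.Dual k C) :
    V.dualAct ψ ∘ₗ V.dualAct φ = V.dualAct (toConv ψ * toConv φ).ofConv := by
  ext v
  have h := LinearMap.congr_fun V.coassoc v
  simp only [LinearMap.comp_apply, LinearEquiv.coe_coe] at h
  rw [LinearMap.comp_apply, dualAct_apply, dualAct_apply, ← rightSlice_rTensor,
    rightSlice_rightSlice, h, rightSlice_lTensor]
  rfl

theorem isSubcomodule_iff_dualAct {V : Comod k C} {U : Submodule k V} :
    V.IsSubcomodule U ↔ ∀ φ, U ∈ (V.dualAct φ).invtSubmodule := by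
  simp only [IsSubcomodule, mem_range_rTensor_subtype_iff, Module.End.mem_invtSubmodule]
  exact ⟨fun h φ x hx => h x hx φ, fun h x hx φ => h φ hx⟩

/-- A linear map between comodules is colinear if it commutes with the coactions. This is the
field `Hom.colinear` as a predicate on linear maps, so that a single map can be considered for
several comodule structures. -/
def IsColinear (V W : Comod k C) (f : V →ₗ[k] W) : Prop :=
  W.coact ∘ₗ f = f.rTensor C ∘ₗ V.coact

theorem isColinear_iff_dualAct {f : V →ₗ[k] W} :
    IsColinear V W f ↔ ∀ φ, W.dualAct φ ∘ₗ f = f ∘ₗ V.dualAct φ := by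
  constructor
  · intro h φ
    ext v
    exact (congrArg (rightSlice φ) (LinearMap.congr_fun h v)).trans (rightSlice_rTensor _ _ _)
  · intro h
    ext v
    refine rightSlice_ext fun φ => ?_
    exact (LinearMap.congr_fun (h φ) v).trans (rightSlice_rTensor _ _ _).symm

theorem IsColinear.dualAct_apply {f : V →ₗ[k] W} (hf : IsColinear V W f) (φ : Module.Dual k C)
    (v : V) : W.dualAct φ (f v) = f (V.dualAct φ v) :=
  LinearMap.congr_fun (isColinear_iff_dualAct.1 hf φ) v

theorem isColinear_id (V : Comod k C) : IsColinear V V LinearMap.id := by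
  rw [IsColinear, LinearMap.rTensor_id]
  rfl

theorem IsColinear.comp {g : V →ₗ[k] W} {f : U →ₗ[k] V}
    (hg : IsColinear V W g) (hf : IsColinear U V f) : IsColinear U W (g ∘ₗ f) := by
  rw [isColinear_iff_dualAct] at *
  intro φ
  rw [← LinearMap.comp_assoc, hg, LinearMap.comp_assoc, hf, LinearMap.comp_assoc]

theorem IsColinear.add {f g : V →ₗ[k] W}
    (hf : IsColinear V W f) (hg : IsColinear V W g) : IsColinear V W (f + g) := by
  rw [isColinear_iff_dualAct] at *
  intro φ
  rw [LinearMap.comp_add, hf, hg, LinearMap.add_comp]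

theorem IsColinear.of_comp_injective {i : V →ₗ[k] W} {f : U →ₗ[k] V}
    (hi : IsColinear V W i) (inj : Function.Injective i) (h : IsColinear U W (i ∘ₗ f)) :
    IsColinear U V f := by
  rw [isColinear_iff_dualAct]
  intro φ
  ext u
  apply inj
  exact (hi.dualAct_apply φ (f u)).symm.trans (h.dualAct_apply φ u)

theorem isColinear_iff_of_isIdempotentElem {e : V →ₗ[k] V} (he : IsIdempotentElem e) :
    IsColinear V V e ↔
      V.IsSubcomodule (LinearMap.range e) ∧ V.IsSubcomodule (LinearMap.ker e) := by
  simp only [isColinear_iff_dualAct, isSubcomodule_iff_dualAct, ← forall_and,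
    ← LinearMap.IsIdempotentElem.commute_iff he]
  exact forall_congr' fun φ => eq_comm

end Colinear

section Prod

variable {k : Type u} [Field k] {C : Type u} [AddCommGroup C] [Module k C] [Coalgebra k C]
  (V W : Comod k C)

/-- The direct sum of two comodules. -/
abbrev prod : Comod k C where
  carrier := V × W
  coact := ((LinearMap.inl k V W).rTensor C ∘ₗ V.coact).coprod
    ((LinearMap.inr k V W).rTensor C ∘ₗ W.coact)
  coassoc := by
    apply LinearMap.prod_ext
    · have h := LinearMap.coprod_inl ((LinearMap.inl k V W).rTensor C ∘ₗ V.coact)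
        ((LinearMap.inr k V W).rTensor C ∘ₗ W.coact)
      rw [assoc_rTensor_coact_comp h, lTensor_coact_comp _ h, V.coassoc]
    · have h := LinearMap.coprod_inr ((LinearMap.inl k V W).rTensor C ∘ₗ V.coact)
        ((LinearMap.inr k V W).rTensor C ∘ₗ W.coact)
      rw [assoc_rTensor_coact_comp h, lTensor_coact_comp _ h, W.coassoc]
  counital := by
    apply LinearMap.prod_ext
    · rw [lTensor_coact_comp _ (LinearMap.coprod_inl _ _), V.counital]
      ext; simp
    · rw [lTensor_coact_comp _ (LinearMap.coprod_inr _ _), W.counital]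
      ext; simp

theorem isColinear_inl : IsColinear V (V.prod W) (LinearMap.inl k V W) :=
  LinearMap.coprod_inl _ _

theorem isColinear_inr : IsColinear W (V.prod W) (LinearMap.inr k V W) :=
  LinearMap.coprod_inr _ _

theorem dualAct_prod (φ : Module.Dual k C) :
    (V.prod W).dualAct φ = (V.dualAct φ).prodMap (W.dualAct φ) := by
  apply LinearMap.prod_ext
  · rw [isColinear_iff_dualAct.1 (isColinear_inl V W)]
    ext <;> simp
  · rw [isColinear_iff_dualAct.1 (isColinear_inr V W)]
    ext <;> simp

theorem isColinear_fst : IsColinear (V.prod W) V (LinearMap.fst k V W) :=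
  isColinear_iff_dualAct.2 fun φ => by rw [dualAct_prod]; rfl

theorem isColinear_snd : IsColinear (V.prod W) W (LinearMap.snd k V W) :=
  isColinear_iff_dualAct.2 fun φ => by rw [dualAct_prod]; rfl

end Prod

section Subcomodule

variable {k : Type u} [Field k] {C : Type u} [AddCommGroup C] [Module k C] [Coalgebra k C]

/-- The coaction of a subcomodule `U ⊆ V`, obtained from that of `V` by inverting the injection
`U ⊗ C → V ⊗ C` on its range. -/
noncomputable def subCoact (V : Comod k C) (U : Submodule k V) (hU : V.IsSubcomodule U) :
    U →ₗ[k] U ⊗[k] C :=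
  LinearMap.codRestrictOfInjective (V.coact ∘ₗ U.subtype) (U.subtype.rTensor C)
    (Module.Flat.rTensor_preserves_injective_linearMap _ U.injective_subtype) fun x => hU x x.2

theorem coact_comp_subtype (V : Comod k C) (U : Submodule k V) (hU : V.IsSubcomodule U) :
    V.coact ∘ₗ U.subtype = U.subtype.rTensor C ∘ₗ V.subCoact U hU :=
  (LinearMap.codRestrictOfInjective_comp _ _ _ _).symm

/-- A subcomodule as a comodule. -/
noncomputable abbrev sub (V : Comod k C) (U : Submodule k V) (hU : V.IsSubcomodule U) :
    Comod k C where
  carrier := U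
  coact := V.subCoact U hU
  coassoc := by
    have h := V.coact_comp_subtype U hU
    have inj := Module.Flat.rTensor_preserves_injective_linearMap (M := C ⊗[k] C)
      U.subtype U.injective_subtype
    rw [← LinearMap.cancel_left inj, ← assoc_rTensor_coact_comp h, ← lTensor_coact_comp _ h,
      V.coassoc]
  counital := by
    have inj := Module.Flat.rTensor_preserves_injective_linearMap (M := k)
      U.subtype U.injective_subtype
    rw [← LinearMap.cancel_left inj, ← lTensor_coact_comp _ (V.coact_comp_subtype U hU),
      V.counital]
    ext; simp

theorem isColinear_subtype (V : Comod k C) (U : Submodule k V) (hU : V.IsSubcomodule U) :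
    IsColinear (V.sub U hU) V U.subtype :=
  V.coact_comp_subtype U hU

theorem IsSubcomodule.sup {V : Comod k C} {U₁ U₂ : Submodule k V} (h₁ : V.IsSubcomodule U₁)
    (h₂ : V.IsSubcomodule U₂) : V.IsSubcomodule (U₁ ⊔ U₂) := by
  rw [isSubcomodule_iff_dualAct] at *
  exact fun φ => Module.End.invtSubmodule.sup_mem (h₁ φ) (h₂ φ)

theorem isSubcomodule_range_dualAct_flip (V : Comod k C) (v : V) :
    V.IsSubcomodule (LinearMap.range (V.dualAct.flip v)) := by
  rw [isSubcomodule_iff_dualAct]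
  rintro ψ _ ⟨φ, rfl⟩
  exact ⟨_, (LinearMap.congr_fun (V.dualAct_comp_dualAct ψ φ) v).symm⟩

theorem finiteDimensional_range_dualAct_flip (V : Comod k C) (v : V) :
    FiniteDimensional k (LinearMap.range (V.dualAct.flip v)) := by
  obtain ⟨J, hJ, y, hy⟩ := Submodule.exists_fg_le_eq_rTensor_subtype (V.coact v)
  have : FiniteDimensional k J := Module.Finite.iff_fg.2 hJ
  refine Submodule.finiteDimensional_of_le (S₂ := J) ?_
  rintro _ ⟨φ, rfl⟩
  exact mem_range_rTensor_subtype_iff.1 ⟨y, hy.symm⟩ φ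

theorem exists_finiteDimensional_isSubcomodule_mem (V : Comod k C) (v : V) :
    ∃ U : Submodule k V, V.IsSubcomodule U ∧ FiniteDimensional k U ∧ v ∈ U :=
  ⟨_, V.isSubcomodule_range_dualAct_flip v, V.finiteDimensional_range_dualAct_flip v,
    Coalgebra.counit, LinearMap.congr_fun V.dualAct_counit v⟩

theorem exists_finiteDimensional_isSubcomodule_le (V : Comod k C) (N : Submodule k V)
    (hN : N.FG) :
    ∃ U : Submodule k V, V.IsSubcomodule U ∧ FiniteDimensional k U ∧ N ≤ U := by
  induction N, hN using Submodule.fg_induction with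
  | singleton x =>
    obtain ⟨U, hU, hfin, hx⟩ := V.exists_finiteDimensional_isSubcomodule_mem x
    exact ⟨U, hU, hfin, (Submodule.span_singleton_le_iff_mem x U).2 hx⟩
  | sup N₁ N₂ _ _ h₁ h₂ =>
    obtain ⟨U₁, hU₁, _, hN₁⟩ := h₁
    obtain ⟨U₂, hU₂, _, hN₂⟩ := h₂
    exact ⟨U₁ ⊔ U₂, hU₁.sup hU₂, inferInstance, sup_le_sup hN₁ hN₂⟩

end Subcomodule

end Comod

/-- The comatrix coalgebra on the basis `E i j`, with comultiplication `E i j ↦ ∑ l, E i l ⊗ E l j`: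
coalgebra morphisms from it are the multiplicative matrices. It is a type synonym, since
`n × n →₀ R` carries the coalgebra structure with group-like basis. -/
def Comatrix (R : Type*) (n : Type*) [Zero R] := n × n →₀ R

namespace Comatrix

variable (R n : Type*) [CommRing R]

noncomputable instance : AddCommGroup (Comatrix R n) :=
  inferInstanceAs (AddCommGroup (n × n →₀ R))

noncomputable instance : Module R (Comatrix R n) :=
  inferInstanceAs (Module R (n × n →₀ R))

/-- The basis of matrix units `E i j`, indexed by the pairs `(i, j)`. -/
noncomputable def basis : Module.Basis (n × n) R (Comatrix R n) :=
  Module.Basis.ofRepr (LinearEquiv.refl R (n × n →₀ R))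

variable [Fintype n] [DecidableEq n]

noncomputable instance : CoalgebraStruct R (Comatrix R n) where
  comul := (basis R n).constr R fun p => ∑ l, basis R n (p.1, l) ⊗ₜ[R] basis R n (l, p.2)
  counit := (basis R n).constr R fun p => if p.1 = p.2 then 1 else 0

theorem comul_basis (i j : n) : Coalgebra.comul (R := R) (basis R n (i, j)) =
    ∑ l, basis R n (i, l) ⊗ₜ[R] basis R n (l, j) :=
  (basis R n).constr_basis R _ _

theorem counit_basis (i j : n) : Coalgebra.counit (R := R) (basis R n (i, j)) =
    if i = j then 1 else 0 :=
  (basis R n).constr_basis R _ _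

noncomputable instance : Coalgebra R (Comatrix R n) where
  coassoc := by
    refine (basis R n).ext fun ⟨i, j⟩ => ?_
    simp only [LinearMap.comp_apply, comul_basis, map_sum, LinearMap.rTensor_tmul,
      LinearMap.lTensor_tmul, TensorProduct.sum_tmul, TensorProduct.tmul_sum,
      LinearEquiv.coe_coe, TensorProduct.assoc_tmul]
    exact Finset.sum_comm
  rTensor_counit_comp_comul := by
    refine (basis R n).ext fun ⟨i, j⟩ => ?_
    simp [comul_basis, counit_basis, TensorProduct.ite_tmul]
  lTensor_counit_comp_comul := by
    refine (basis R n).ext fun ⟨i, j⟩ => ?_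
    simp [comul_basis, counit_basis, TensorProduct.tmul_ite]

end Comatrix

namespace Comod

section Coefficients

variable {k : Type u} [Field k] {C : Type u} [AddCommGroup C] [Module k C] [Coalgebra k C]
  {n : Type*}

/-- The matrix coefficients `cᵢⱼ` of a comodule with respect to a basis, determined by
`bⱼ ↦ ∑ᵢ bᵢ ⊗ cᵢⱼ`. -/
noncomputable def coeff (V : Comod k C) (b : Module.Basis n k V) (i j : n) : C :=
  TensorProduct.lid k C ((b.coord i).rTensor C (V.coact (b j)))

theorem apply_coeff (φ : Module.Dual k C) (V : Comod k C) (b : Module.Basis n k V) (i j : n) :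
    φ (V.coeff b i j) = b.coord i (V.dualAct φ (b j)) := by
  rw [coeff, dualAct_apply]
  induction V.coact (b j) <;> simp_all [mul_comm]

theorem coeff_map_eq_iff {V W : Comod k C} (b : Module.Basis n k V) (e : V ≃ₗ[k] W) :
    (∀ i j, W.coeff (b.map e) i j = V.coeff b i j) ↔ IsColinear V W e.toLinearMap := by
  have dual_iff (i j : n) : W.coeff (b.map e) i j = V.coeff b i j ↔
      ∀ φ, b.coord i (e.symm (W.dualAct φ (e (b j)))) = b.coord i (V.dualAct φ (b j)) := by
    rw [← (Module.eval_apply_injective k).eq_iff, LinearMap.ext_iff]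
    exact forall_congr' fun φ => by
      rw [Module.Dual.eval_apply, Module.Dual.eval_apply, apply_coeff, apply_coeff]
      rfl
  simp only [dual_iff, isColinear_iff_dualAct]
  constructor
  · intro h φ
    refine b.ext fun j => ?_
    rw [LinearMap.comp_apply, LinearMap.comp_apply, LinearEquiv.coe_coe, ← e.symm_apply_eq]
    exact b.ext_elem fun i => h i j φ
  · intro h i j φ
    exact congrArg (b.coord i) (e.symm_apply_eq.2 (LinearMap.congr_fun (h φ) (b j)))

theorem coact_basis [Fintype n] (V : Comod k C) (b : Module.Basis n k V) (j : n) :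
    V.coact (b j) = ∑ i, b i ⊗ₜ[k] V.coeff b i j := by
  classical
  apply (TensorProduct.equivFinsuppOfBasisLeft b).injective
  ext i
  simp [TensorProduct.equivFinsuppOfBasisLeft_apply, coeff, Finsupp.single_apply]

theorem counit_coeff [DecidableEq n] (V : Comod k C) (b : Module.Basis n k V) (i j : n) :
    Coalgebra.counit (R := k) (V.coeff b i j) = if i = j then 1 else 0 := by
  rw [apply_coeff, dualAct_counit, LinearMap.id_apply, Module.Basis.coord_apply, b.repr_self,
    Finsupp.single_apply]
  simp only [eq_comm]

theorem comul_coeff [Fintype n] (V : Comod k C) (b : Module.Basis n k V) (i j : n) :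
    Coalgebra.comul (R := k) (V.coeff b i j) =
      ∑ l, V.coeff b i l ⊗ₜ[k] V.coeff b l j := by
  classical
  have h := congrArg (fun t => TensorProduct.lid k (C ⊗[k] C) ((b.coord i).rTensor _ t))
    (LinearMap.congr_fun V.coassoc (b j))
  simp only [LinearMap.comp_apply, V.coact_basis b, map_sum, LinearMap.lTensor_tmul,
    LinearMap.rTensor_tmul, TensorProduct.sum_tmul, LinearEquiv.coe_coe,
    TensorProduct.assoc_tmul, TensorProduct.lid_tmul] at h
  simpa [Finsupp.single_apply] using h.symm

/-- The coalgebra morphism from the comatrix coalgebra given by the matrix coefficients. -/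
noncomputable def coeffHom [Fintype n] [DecidableEq n] (V : Comod k C) (b : Module.Basis n k V) :
    Comatrix k n →ₗc[k] C where
  toLinearMap := (Comatrix.basis k n).constr k fun p => V.coeff b p.1 p.2
  counit_comp := by
    refine (Comatrix.basis k n).ext fun ⟨i, j⟩ => ?_
    simp [counit_coeff, Comatrix.counit_basis]
  map_comp_comul := by
    refine (Comatrix.basis k n).ext fun ⟨i, j⟩ => ?_
    simp [comul_coeff, Comatrix.comul_basis]

theorem coeffHom_basis [Fintype n] [DecidableEq n] (V : Comod k C) (b : Module.Basis n k V)
    (i j : n) :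
    V.coeffHom b (Comatrix.basis k n (i, j)) = V.coeff b i j :=
  (Comatrix.basis k n).constr_basis k _ _

end Coefficients

section Corestriction

variable {k : Type u} [Field k] {H H' : Type u} [AddCommGroup H] [Module k H] [Coalgebra k H]
  [AddCommGroup H'] [Module k H'] [Coalgebra k H'] (π : H →ₗc[k] H')

theorem dualAct_corestrict (V : Comod k H) (φ : Module.Dual k H') :
    (corestrict π V).dualAct φ = V.dualAct (φ ∘ₗ π.toLinearMap) :=
  LinearMap.ext fun v => rightSlice_lTensor φ π.toLinearMap (V.coact v)

theorem coeff_corestrict {n : Type*} (V : Comod k H) (b : Module.Basis n k V) (i j : n) :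
    (corestrict π V).coeff b i j = π (V.coeff b i j) := by
  apply Module.eval_apply_injective k
  ext φ
  rw [Module.Dual.eval_apply, Module.Dual.eval_apply, apply_coeff, dualAct_corestrict]
  exact (apply_coeff (φ ∘ₗ π.toLinearMap) V b i j).symm

theorem IsColinear.corestrict {V W : Comod k H} {f : V →ₗ[k] W} (hf : IsColinear V W f) :
    IsColinear (corestrict π V) (corestrict π W) f :=
  lTensor_coact_comp π.toLinearMap hf

/-- Every `H'`-colinear map from `V` to `W` is `H`-colinear. For all `V` and `W` this is fullness
of the corestriction functor, which is the identity on underlying maps. -/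
def ColinearMapsLift (V W : Comod k H) : Prop :=
  ∀ f : V →ₗ[k] W, IsColinear (corestrict π V) (corestrict π W) f → IsColinear V W f

theorem full_corestriction_iff :
    (corestriction π).Full ↔ ∀ V W : Comod k H, ColinearMapsLift π V W := by
  constructor
  · intro _ V W f hf
    obtain ⟨g, hg⟩ := (corestriction π).map_surjective (X := V) (Y := W) ⟨f, hf⟩
    obtain rfl : g.toLinearMap = f := congrArg Hom.toLinearMap hg
    exact g.colinear
  · intro h
    exact ⟨fun {V W} f => ⟨⟨f.toLinearMap, h V W _ f.colinear⟩, rfl⟩⟩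

theorem full_corestrictionFin_iff :
    (corestrictionFin π).Full ↔ ∀ V W : Comod k H, FiniteDimensional k V →
      FiniteDimensional k W → ColinearMapsLift π V W := by
  constructor
  · intro _ V W hV hW f hf
    let V' : (finDim k H).FullSubcategory := ⟨V, hV⟩
    let W' : (finDim k H).FullSubcategory := ⟨W, hW⟩
    let f' : (corestrictionFin π).obj V' ⟶ (corestrictionFin π).obj W' :=
      ObjectProperty.homMk ⟨f, hf⟩
    obtain ⟨g, hg⟩ := (corestrictionFin π).map_surjective f'
    obtain rfl : g.hom.toLinearMap = f := congrArg (fun m => m.hom.toLinearMap) hg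
    exact g.hom.colinear
  · intro h
    exact ⟨fun {V W} f => ⟨ObjectProperty.homMk
      ⟨f.hom.toLinearMap, h V.obj W.obj V.property W.property _ f.hom.colinear⟩, rfl⟩⟩

variable {π}

theorem idempotentsLift_iff {V : Comod k H} :
    IdempotentsLift π V ↔ ∀ e : V →ₗ[k] V, IsIdempotentElem e →
      IsColinear (corestrict π V) (corestrict π V) e → IsColinear V V e := by
  constructor
  · intro h e idem he
    obtain ⟨g, hg⟩ := h ⟨e, he⟩ (Hom.ext idem)
    obtain rfl : g.toLinearMap = e := congrArg Hom.toLinearMap hg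
    exact g.colinear
  · intro h e idem
    exact ⟨⟨e.toLinearMap, h _ (congrArg Hom.toLinearMap idem) e.colinear⟩, rfl⟩

theorem idempotentsLift_iff_decompositionsLift {V : Comod k H} :
    IdempotentsLift π V ↔ DecompositionsLift π V := by
  rw [idempotentsLift_iff]
  constructor
  · intro h V₁ V₂ compl h₁ h₂
    have idem := Submodule.isIdempotentElem_projection compl
    have := h _ idem ((isColinear_iff_of_isIdempotentElem (V := corestrict π V) idem).2
      (by rw [Submodule.range_projection, Submodule.ker_projection]; exact ⟨h₁, h₂⟩))
    rwa [isColinear_iff_of_isIdempotentElem idem, Submodule.range_projection,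
      Submodule.ker_projection] at this
  · intro h e idem he
    obtain ⟨h₁, h₂⟩ := (isColinear_iff_of_isIdempotentElem (V := corestrict π V) idem).1 he
    exact (isColinear_iff_of_isIdempotentElem idem).2
      (h _ _ (LinearMap.IsIdempotentElem.isCompl idem) h₁ h₂)

theorem ColinearMapsLift.idempotentsLift {V : Comod k H} (h : ColinearMapsLift π V V) :
    IdempotentsLift π V :=
  idempotentsLift_iff.2 fun e _ => h e

theorem colinearMapsLift_of_idempotentsLift_prod {V W : Comod k H}
    (h : IdempotentsLift π (V.prod W)) : ColinearMapsLift π V W := by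
  intro f hf
  -- The projection of `V × W` onto the graph of `f` along `W`.
  let e : V × W →ₗ[k] V × W :=
    (LinearMap.inl k V W + LinearMap.inr k V W ∘ₗ f) ∘ₗ LinearMap.fst k V W
  have idem : IsIdempotentElem e := by
    ext <;> simp [e]
  have he : IsColinear (V.prod W) (V.prod W) e := by
    have inl := (isColinear_inl V W).corestrict π
    have inr := (isColinear_inr V W).corestrict π
    have fst := (isColinear_fst V W).corestrict π
    exact idempotentsLift_iff.1 h e idem ((inl.add (inr.comp hf)).comp fst)
  have hf_eq : f = LinearMap.snd k V W ∘ₗ e ∘ₗ LinearMap.inl k V W := by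
    ext; simp [e]
  rw [hf_eq]
  exact (isColinear_snd V W).comp (he.comp (isColinear_inl V W))

theorem colinearMapsLift_of_finiteDimensional
    (h : ∀ V W : Comod k H, FiniteDimensional k V → FiniteDimensional k W →
      ColinearMapsLift π V W)
    (V W : Comod k H) : ColinearMapsLift π V W := by
  intro f hf
  rw [isColinear_iff_dualAct]
  intro φ
  ext v
  obtain ⟨V₀, hV₀, finV₀, hv⟩ := V.exists_finiteDimensional_isSubcomodule_mem v
  obtain ⟨W₀, hW₀, finW₀, hfV₀⟩ := W.exists_finiteDimensional_isSubcomodule_le (V₀.map f)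
    ((Module.Finite.iff_fg.1 finV₀).map f)
  have inclV := V.isColinear_subtype V₀ hV₀
  have inclW := W.isColinear_subtype W₀ hW₀
  let f₀ : V₀ →ₗ[k] W₀ := f.restrict fun x hx => hfV₀ (Submodule.mem_map_of_mem hx)
  have hf₀ : IsColinear (V.sub V₀ hV₀) (W.sub W₀ hW₀) f₀ :=
    h (V.sub V₀ hV₀) (W.sub W₀ hW₀) finV₀ finW₀ f₀ ((inclW.corestrict π).of_comp_injective
      W₀.injective_subtype (hf.comp (inclV.corestrict π)))
  calc W.dualAct φ (f v)
      = f ((V.sub V₀ hV₀).dualAct φ ⟨v, hv⟩).1 := (inclW.comp hf₀).dualAct_apply φ ⟨v, hv⟩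
    _ = f (V.dualAct φ v) := congrArg f (inclV.dualAct_apply φ ⟨v, hv⟩).symm

theorem mono_ofHom_iff :
    Mono (CoalgCat.ofHom π) ↔ ∀ (C : Type u) [AddCommGroup C] [Module k C] [Coalgebra k C]
      (f g : C →ₗc[k] H), π.comp f = π.comp g → f = g := by
  constructor
  · intro _ C _ _ _ f g h
    have : CoalgCat.ofHom f = CoalgCat.ofHom g := by
      rw [← cancel_mono (CoalgCat.ofHom π)]
      exact CoalgCat.Hom.ext h
    exact congrArg CoalgCat.Hom.toCoalgHom' this
  · intro h
    exact ⟨fun f g hfg => CoalgCat.Hom.ext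
      (h _ f.toCoalgHom' g.toCoalgHom' (congrArg CoalgCat.Hom.toCoalgHom' hfg))⟩

theorem counit_dualAct_regular (φ : Module.Dual k H) (c : H) :
    Coalgebra.counit (R := k) ((regular k H).dualAct φ c) = φ c := by
  rw [dualAct_apply, ← rightSlice_rTensor, Coalgebra.rTensor_counit_comul, rightSlice_tmul,
    smul_eq_mul, mul_one]

theorem mono_of_colinearMapsLift (h : ∀ V W : Comod k H, ColinearMapsLift π V W) :
    Mono (CoalgCat.ofHom π) := by
  rw [mono_ofHom_iff]
  intro C _ _ _ f g hfg
  -- As `π f = π g`, the comodules `f_* C` and `g_* C` have the same corestriction to `H'`.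
  have hid : IsColinear (corestrict f (regular k C)) (corestrict g (regular k C))
      LinearMap.id := by
    refine h _ _ _ (isColinear_iff_dualAct.2 fun φ => ?_)
    have h_eq : (φ ∘ₗ π.toLinearMap) ∘ₗ f.toLinearMap = (φ ∘ₗ π.toLinearMap) ∘ₗ g.toLinearMap :=
      congrArg (fun j : C →ₗc[k] H' => φ ∘ₗ j.toLinearMap) hfg
    rw [dualAct_corestrict, dualAct_corestrict, dualAct_corestrict, dualAct_corestrict, h_eq]
    rfl
  ext c
  apply Module.eval_apply_injective k
  ext φ
  calc φ (f c) = Coalgebra.counit ((corestrict f (regular k C)).dualAct φ c) := by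
        rw [dualAct_corestrict]
        exact (counit_dualAct_regular (φ ∘ₗ f.toLinearMap) c).symm
    _ = Coalgebra.counit ((corestrict g (regular k C)).dualAct φ c) :=
        congrArg _ (hid.dualAct_apply φ c).symm
    _ = φ (g c) := by
        rw [dualAct_corestrict]
        exact counit_dualAct_regular (φ ∘ₗ g.toLinearMap) c

theorem isColinear_equiv_of_mono (hπ : Mono (CoalgCat.ofHom π))
    {V W : Comod k H} [FiniteDimensional k V] (e : V ≃ₗ[k] W)
    (he : IsColinear (corestrict π V) (corestrict π W) e.toLinearMap) :
    IsColinear V W e.toLinearMap := by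
  let b := Module.finBasis k V
  have coeffHom_eq : W.coeffHom (b.map e) = V.coeffHom b := by
    refine mono_ofHom_iff.1 hπ _ _ _ (CoalgHom.coe_linearMap_injective ?_)
    refine (Comatrix.basis k _).ext fun ⟨i, j⟩ => ?_
    have h := (coeff_map_eq_iff (V := corestrict π V) (W := corestrict π W) b e).2 he i j
    rw [coeff_corestrict, coeff_corestrict, ← coeffHom_basis, ← coeffHom_basis] at h
    exact h
  refine (coeff_map_eq_iff b e).1 fun i j => ?_
  rw [← coeffHom_basis, ← coeffHom_basis, coeffHom_eq]

theorem colinearMapsLift_of_mono (hπ : Mono (CoalgCat.ofHom π))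
    (V W : Comod k H) [FiniteDimensional k V] [FiniteDimensional k W] :
    ColinearMapsLift π V W := by
  intro f hf
  -- The automorphism `(v, w) ↦ (v, w + f v)`: matrix coefficients compare along isomorphisms.
  let e : (V × W) ≃ₗ[k] V × W := (LinearEquiv.refl k V).skewProd (LinearEquiv.refl k W) f
  have he : IsColinear (V.prod W) (V.prod W) e.toLinearMap := by
    have inr := (isColinear_inr V W).corestrict π
    have fst := (isColinear_fst V W).corestrict π
    have e_eq : e.toLinearMap =
        LinearMap.id + LinearMap.inr k V W ∘ₗ f ∘ₗ LinearMap.fst k V W := by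
      ext <;> simp [e]
    refine isColinear_equiv_of_mono hπ (V := V.prod W) (W := V.prod W) e ?_
    rw [e_eq]
    exact (isColinear_id _).add (inr.comp (hf.comp fst))
  have hf_eq : f = LinearMap.snd k V W ∘ₗ e.toLinearMap ∘ₗ LinearMap.inl k V W := by
    ext; simp [e]
  rw [hf_eq]
  exact (isColinear_snd V W).comp (he.comp (isColinear_inl V W))

theorem tfae_mono (π : H →ₗc[k] H') : List.TFAE [
    Mono (CoalgCat.ofHom π),
    (corestriction π).Full,
    (corestrictionFin π).Full,
    ∀ V : Comod k H, IdempotentsLift π V,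
    ∀ V : Comod k H, FiniteDimensional k V → IdempotentsLift π V,
    ∀ V : Comod k H, DecompositionsLift π V,
    ∀ V : Comod k H, FiniteDimensional k V → DecompositionsLift π V] := by
  simp only [full_corestriction_iff, full_corestrictionFin_iff,
    ← idempotentsLift_iff_decompositionsLift]
  tfae_have 1 → 3 := fun h V W _ _ => colinearMapsLift_of_mono h V W
  tfae_have 3 → 2 := colinearMapsLift_of_finiteDimensional
  tfae_have 2 → 1 := mono_of_colinearMapsLift
  tfae_have 2 → 4 := fun h V => (h V V).idempotentsLift
  tfae_have 4 → 5 := fun h V _ => h V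
  tfae_have 5 → 3 := fun h V W _ _ =>
    colinearMapsLift_of_idempotentsLift_prod (h (V.prod W) inferInstance)
  tfae_have 4 ↔ 6 := Iff.rfl
  tfae_have 5 ↔ 7 := Iff.rfl
  tfae_finish

end Corestriction

end Comod

section Convolution

open WithConv

variable {R : Type*} [CommSemiring R]
  {A B : Type*} [Semiring A] [Algebra R A] [Semiring B] [Algebra R B]
  {C D : Type*} [AddCommMonoid C] [Module R C] [Coalgebra R C]
  [AddCommMonoid D] [Module R D] [Coalgebra R D]

variable (C) in
/-- Composition with an algebra morphism, as a morphism of convolution monoids. -/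
noncomputable def convPostcomp (φ : A →ₐ[R] B) :
    WithConv (C →ₗ[R] A) →* WithConv (C →ₗ[R] B) where
  toFun f := toConv (φ.toLinearMap ∘ₗ f.ofConv)
  map_one' := by
    apply WithConv.ext
    ext
    simp [LinearMap.convOne_def]
  map_mul' f g := WithConv.ext (LinearMap.algHom_comp_convMul_distrib φ f g)

variable (A) in
/-- Composition with a coalgebra morphism, as a morphism of convolution monoids. -/
noncomputable def convPrecomp (f : C →ₗc[R] D) :
    WithConv (D →ₗ[R] A) →* WithConv (C →ₗ[R] A) where
  toFun g := toConv (g.ofConv ∘ₗ f.toLinearMap)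
  map_one' := by
    apply WithConv.ext
    ext
    simp [LinearMap.convOne_def]
  map_mul' g h := WithConv.ext (LinearMap.convMul_comp_coalgHom_distrib g h f)

/-- A coalgebra morphism `f` to a Hopf algebra as a convolution unit, with inverse `S ∘ f`. -/
noncomputable def coalgHomUnit {H : Type*} [Semiring H] [HopfAlgebra R H] (f : C →ₗc[R] H) :
    (WithConv (C →ₗ[R] H))ˣ :=
  Units.map (convPrecomp H f) ⟨toConv LinearMap.id, toConv (HopfAlgebra.antipode R),
    LinearMap.id_mul_antipode, LinearMap.antipode_mul_id⟩

theorem coalgHomUnit_injective {H : Type*} [Semiring H] [HopfAlgebra R H] :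
    Function.Injective (coalgHomUnit : (C →ₗc[R] H) → (WithConv (C →ₗ[R] H))ˣ) :=
  fun _ _ h => CoalgHom.coe_linearMap_injective
    (congrArg (fun u : (WithConv (C →ₗ[R] H))ˣ => u.val.ofConv) h)

theorem map_counit_coalgHomUnit {H : Type*} [Semiring H] [HopfAlgebra R H] (f : C →ₗc[R] H) :
    Units.map (convPostcomp C (Bialgebra.counitAlgHom R H)) (coalgHomUnit f) = 1 :=
  Units.ext (WithConv.ext f.counit_comp)

section RegularCoaction

variable {H H' : Type*} [Semiring H] [HopfAlgebra R H] [Semiring H'] [Bialgebra R H']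
  (π : H →ₐc[R] H')

/-- The coaction `h ↦ h₁ ⊗ π(h₂)` of `H'` on `H`, as an algebra morphism. -/
noncomputable def regularCoaction : H →ₐ[R] H ⊗[R] H' :=
  (Algebra.TensorProduct.map (AlgHom.id R H) (π : H →ₐ[R] H')).comp (Bialgebra.comulAlgHom R H)

theorem map_regularCoaction_coalgHomUnit (f : C →ₗc[R] H) :
    Units.map (convPostcomp C (regularCoaction π)) (coalgHomUnit f) =
      Units.map (convPostcomp C Algebra.TensorProduct.includeLeft) (coalgHomUnit f) *
        Units.map (convPostcomp C (Algebra.TensorProduct.includeRight.comp (π : H →ₐ[R] H')))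
          (coalgHomUnit f) := by
  have mul_inclusions : LinearMap.mul' R (H ⊗[R] H') ∘ₗ TensorProduct.map
        ((Algebra.TensorProduct.includeLeft : H →ₐ[R] H ⊗[R] H').toLinearMap ∘ₗ f.toLinearMap)
        ((Algebra.TensorProduct.includeRight.comp (π : H →ₐ[R] H')).toLinearMap ∘ₗ
          f.toLinearMap) =
      (Algebra.TensorProduct.map (AlgHom.id R H) (π : H →ₐ[R] H')).toLinearMap ∘ₗ
        TensorProduct.map f.toLinearMap f.toLinearMap := by
    ext; simp
  apply Units.ext
  apply WithConv.ext
  exact (congrArg ((Algebra.TensorProduct.map (AlgHom.id R H) (π : H →ₐ[R] H')).toLinearMap ∘ₗ ·)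
    f.map_comp_comul.symm).trans (congrArg (· ∘ₗ Coalgebra.comul) mul_inclusions.symm)

theorem map_regularCoaction_coalgHomUnit_div {f g : C →ₗc[R] H}
    (h : (π : H →ₗc[R] H').comp f = (π : H →ₗc[R] H').comp g) :
    Units.map (convPostcomp C (regularCoaction π)) (coalgHomUnit f / coalgHomUnit g) =
      Units.map (convPostcomp C Algebra.TensorProduct.includeLeft)
        (coalgHomUnit f / coalgHomUnit g) := by
  have right_eq : Units.map (convPostcomp C
        ((Algebra.TensorProduct.includeRight : H' →ₐ[R] H ⊗[R] H').comp (π : H →ₐ[R] H')))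
          (coalgHomUnit f) =
      Units.map (convPostcomp C (Algebra.TensorProduct.includeRight.comp (π : H →ₐ[R] H')))
        (coalgHomUnit g) :=
    Units.ext (WithConv.ext (congrArg (fun j : C →ₗc[R] H' =>
      (Algebra.TensorProduct.includeRight : H' →ₐ[R] H ⊗[R] H').toLinearMap ∘ₗ j.toLinearMap) h))
  rw [map_div, map_div, map_regularCoaction_coalgHomUnit, map_regularCoaction_coalgHomUnit,
    right_eq, mul_div_mul_right_eq_div]

end RegularCoaction

end Convolution

namespace Comod

section Coinvariants

variable {k : Type u} [Field k] {H H' : Type u} [Ring H] [Bialgebra k H] [Ring H']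
  [Bialgebra k H'] (π : H →ₐc[k] H')

theorem mem_coinvariants_iff_dualAct {V : Comod k H} {v : V} :
    v ∈ V.coinvariants ↔ ∀ φ, V.dualAct φ v = φ 1 • v := by
  constructor
  · intro hv φ
    exact (congrArg (rightSlice φ) hv).trans (rightSlice_tmul φ v 1)
  · intro h
    exact rightSlice_ext fun φ => (h φ).trans (rightSlice_tmul φ v 1).symm

theorem coinvariants_le_corestrict (V : Comod k H) :
    V.coinvariants ≤ (corestrict (π : H →ₗc[k] H') V).coinvariants := by
  intro v hv
  rw [mem_coinvariants_iff_dualAct] at *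
  intro φ
  rw [dualAct_corestrict, hv]
  exact congrArg (fun a => φ a • v) (map_one π)

theorem IsColinear.apply_mem_coinvariants {V W : Comod k H} {i : V →ₗ[k] W}
    (hi : IsColinear V W i) {v : V} (hv : v ∈ V.coinvariants) : i v ∈ W.coinvariants := by
  rw [mem_coinvariants_iff_dualAct] at *
  exact fun φ => by rw [hi.dualAct_apply, hv, map_smul]

theorem IsColinear.apply_mem_coinvariants_iff {V W : Comod k H} {i : V →ₗ[k] W}
    (hi : IsColinear V W i) (inj : Function.Injective i) {v : V} :
    i v ∈ W.coinvariants ↔ v ∈ V.coinvariants := by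
  simp only [mem_coinvariants_iff_dualAct, hi.dualAct_apply, ← map_smul, inj.eq_iff]

theorem coinvariants_corestrict_eq_of_finiteDimensional
    (h : ∀ V : Comod k H, FiniteDimensional k V →
      (corestrict (π : H →ₗc[k] H') V).coinvariants = V.coinvariants) (V : Comod k H) :
    (corestrict (π : H →ₗc[k] H') V).coinvariants = V.coinvariants := by
  ext v
  obtain ⟨U, hU, fin, hv⟩ := V.exists_finiteDimensional_isSubcomodule_mem v
  have incl := V.isColinear_subtype U hU
  calc v ∈ (corestrict (π : H →ₗc[k] H') V).coinvariants
      ↔ (⟨v, hv⟩ : U) ∈ (corestrict (π : H →ₗc[k] H') (V.sub U hU)).coinvariants :=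
        (incl.corestrict _).apply_mem_coinvariants_iff U.injective_subtype (v := ⟨v, hv⟩)
    _ ↔ (⟨v, hv⟩ : U) ∈ (V.sub U hU).coinvariants := by rw [h _ fin]
    _ ↔ v ∈ V.coinvariants :=
        (incl.apply_mem_coinvariants_iff U.injective_subtype (v := ⟨v, hv⟩)).symm

variable (k H) in
/-- The ground field as a comodule with the trivial coaction `a ↦ a ⊗ 1`; colinear maps from it to
`V` are the coinvariants of `V`. -/
noncomputable abbrev trivial : Comod k H where
  carrier := k
  coact := (TensorProduct.mk k k H).flip 1
  coassoc := by ext; simp [Algebra.TensorProduct.one_def]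
  counital := by ext; simp

theorem coinvariants_corestrict_eq_of_colinearMapsLift {V : Comod k H}
    (h : ColinearMapsLift (π : H →ₗc[k] H') (trivial k H) V) :
    (corestrict (π : H →ₗc[k] H') V).coinvariants = V.coinvariants := by
  refine le_antisymm (fun v hv => ?_) (coinvariants_le_corestrict π V)
  have one_mem : (1 : k) ∈ (trivial k H).coinvariants := rfl
  have hlift : IsColinear (trivial k H) V (LinearMap.toSpanSingleton k V v) := by
    refine h _ (isColinear_iff_dualAct.2 fun φ => LinearMap.ext_ring ?_)
    have h_one := mem_coinvariants_iff_dualAct.1 (coinvariants_le_corestrict π _ one_mem) φ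
    have h_v := mem_coinvariants_iff_dualAct.1 hv φ
    rw [LinearMap.comp_apply, LinearMap.comp_apply, h_one, map_smul,
      LinearMap.toSpanSingleton_apply, one_smul]
    exact h_v
  simpa using hlift.apply_mem_coinvariants one_mem

theorem coinvariants_regular : (regular k H).coinvariants = Submodule.span k {(1 : H)} := by
  apply le_antisymm
  · intro x hx
    have hx_eq : x = Coalgebra.counit (R := k) x • (1 : H) := by
      apply Module.eval_apply_injective k
      ext φ
      rw [Module.Dual.eval_apply, Module.Dual.eval_apply, ← counit_dualAct_regular,
        mem_coinvariants_iff_dualAct.1 hx, map_smul, map_smul, smul_eq_mul, smul_eq_mul, mul_comm]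
    rw [hx_eq]
    exact Submodule.smul_mem _ _ (Submodule.mem_span_singleton_self _)
  · rw [Submodule.span_singleton_le_iff_mem]
    exact Bialgebra.comul_one

end Coinvariants

theorem coalgHom_ext_of_coinvariants_regular {k : Type u} [Field k] {H H' : Type u}
    [Ring H] [HopfAlgebra k H] [Ring H'] [Bialgebra k H'] {π : H →ₐc[k] H'}
    (hπ : (corestrict (π : H →ₗc[k] H') (regular k H)).coinvariants =
      Submodule.span k {(1 : H)})
    {C : Type*} [AddCommGroup C] [Module k C] [Coalgebra k C] {f g : C →ₗc[k] H}
    (h : (π : H →ₗc[k] H').comp f = (π : H →ₗc[k] H').comp g) : f = g := by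
  -- `q = f * (S ∘ g)` takes values in the coinvariants, because `π f = π g`.
  let q := coalgHomUnit f / coalgHomUnit g
  have counit_q (c : C) :
      Coalgebra.counit (R := k) (q.val.ofConv c) = Coalgebra.counit (R := k) c := by
    have hq : Units.map (convPostcomp C (Bialgebra.counitAlgHom k H)) q = 1 := by
      rw [map_div, map_counit_coalgHomUnit, map_counit_coalgHomUnit, div_one]
    exact congrArg (fun u : (WithConv (C →ₗ[k] k))ˣ => u.val.ofConv c) hq
  have q_eq_one : q = 1 := by
    apply Units.ext
    apply WithConv.ext
    ext c
    have hc : q.val.ofConv c ∈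
        (corestrict (π : H →ₗc[k] H') (regular k H)).coinvariants :=
      congrArg (fun u : (WithConv (C →ₗ[k] H ⊗[k] H'))ˣ => u.val.ofConv c)
        (map_regularCoaction_coalgHomUnit_div π h)
    rw [hπ, Submodule.mem_span_singleton] at hc
    obtain ⟨r, hr⟩ := hc
    have r_eq : r = Coalgebra.counit c := by
      rw [← counit_q, ← hr, map_smul, Bialgebra.counit_one, smul_eq_mul, mul_one]
    rw [← hr, r_eq]
    exact (Algebra.algebraMap_eq_smul_one _).symm
  exact coalgHomUnit_injective (div_eq_one.1 q_eq_one)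

end Comod

theorem mainTheorem1_general (k : Type u) [Field k] :
    (∀ (H H' : Type u) [AddCommGroup H] [Module k H] [Coalgebra k H]
        [AddCommGroup H'] [Module k H'] [Coalgebra k H'] (π : H →ₗc[k] H'),
      List.TFAE [
        Mono (CoalgCat.ofHom π),
        (Comod.corestriction π).Full,
        (Comod.corestrictionFin π).Full,
        ∀ V : Comod k H, Comod.IdempotentsLift π V,
        ∀ V : Comod k H, FiniteDimensional k V → Comod.IdempotentsLift π V,
        ∀ V : Comod k H, Comod.DecompositionsLift π V,
        ∀ V : Comod k H, FiniteDimensional k V → Comod.DecompositionsLift π V]) ∧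
    (∀ (H H' : Type u) [Ring H] [HopfAlgebra k H] [Ring H'] [Bialgebra k H']
        (π : H →ₐc[k] H'),
      List.TFAE [
        Mono (CoalgCat.ofHom (π : H →ₗc[k] H')),
        (Comod.corestriction (π : H →ₗc[k] H')).Full,
        (Comod.corestrictionFin (π : H →ₗc[k] H')).Full,
        ∀ V : Comod k H, Comod.IdempotentsLift (π : H →ₗc[k] H') V,
        ∀ V : Comod k H, FiniteDimensional k V → Comod.IdempotentsLift (π : H →ₗc[k] H') V,
        ∀ V : Comod k H, Comod.DecompositionsLift (π : H →ₗc[k] H') V,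
        ∀ V : Comod k H, FiniteDimensional k V → Comod.DecompositionsLift (π : H →ₗc[k] H') V,
        ∀ V : Comod k H,
          (Comod.corestrict (π : H →ₗc[k] H') V).coinvariants = V.coinvariants,
        ∀ V : Comod k H, FiniteDimensional k V →
          (Comod.corestrict (π : H →ₗc[k] H') V).coinvariants = V.coinvariants,
        (Comod.corestrict (π : H →ₗc[k] H') (Comod.regular k H)).coinvariants =
          Submodule.span k {(1 : H)}]) := by
  refine ⟨fun H H' _ _ _ _ _ _ π => Comod.tfae_mono π, fun H H' _ _ _ _ π => ?_⟩
  have h := Comod.tfae_mono (π : H →ₗc[k] H')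
  tfae_have 1 ↔ 2 := h.out 0 1
  tfae_have 1 ↔ 3 := h.out 0 2
  tfae_have 1 ↔ 4 := h.out 0 3
  tfae_have 1 ↔ 5 := h.out 0 4
  tfae_have 1 ↔ 6 := h.out 0 5
  tfae_have 1 ↔ 7 := h.out 0 6
  tfae_have 2 → 8 := fun full V => Comod.coinvariants_corestrict_eq_of_colinearMapsLift π
    ((Comod.full_corestriction_iff _).1 full _ V)
  tfae_have 8 → 9 := fun coinv V _ => coinv V
  tfae_have 9 → 8 := Comod.coinvariants_corestrict_eq_of_finiteDimensional π
  tfae_have 8 → 10 := fun coinv => (coinv _).trans Comod.coinvariants_regular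
  tfae_have 10 → 1 := fun coinv => Comod.mono_ofHom_iff.2 fun _ _ _ _ _ _ =>
    Comod.coalgHom_ext_of_coinvariants_regular coinv
  tfae_finish

theorem mainTheorem1 (k : Type u) [Field k] :
    (∀ (H H' : Type u) [AddCommGroup H] [Module k H] [Coalgebra k H]
        [AddCommGroup H'] [Module k H'] [Coalgebra k H'] (π : H →ₗc[k] H'),
      List.TFAE [
        Mono (CoalgCat.ofHom π),
        (Comod.corestriction π).Full,
        (Comod.corestrictionFin π).Full,
        ∀ V : Comod k H, Comod.IdempotentsLift π V,
        ∀ V : Comod k H, FiniteDimensional k V → Comod.IdempotentsLift π V,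
        ∀ V : Comod k H, Comod.DecompositionsLift π V,
        ∀ V : Comod k H, FiniteDimensional k V → Comod.DecompositionsLift π V]) ∧
    (∀ (H H' : Type u) [Ring H] [HopfAlgebra k H] [Ring H'] [HopfAlgebra k H']
        (π : H →ₐc[k] H'),
      List.TFAE [
        Mono (CoalgCat.ofHom (π : H →ₗc[k] H')),
        (Comod.corestriction (π : H →ₗc[k] H')).Full,
        (Comod.corestrictionFin (π : H →ₗc[k] H')).Full,
        ∀ V : Comod k H, Comod.IdempotentsLift (π : H →ₗc[k] H') V,
        ∀ V : Comod k H, FiniteDimensional k V → Comod.IdempotentsLift (π : H →ₗc[k] H') V,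
        ∀ V : Comod k H, Comod.DecompositionsLift (π : H →ₗc[k] H') V,
        ∀ V : Comod k H, FiniteDimensional k V → Comod.DecompositionsLift (π : H →ₗc[k] H') V,
        ∀ V : Comod k H,
          (Comod.corestrict (π : H →ₗc[k] H') V).coinvariants = V.coinvariants,
        ∀ V : Comod k H, FiniteDimensional k V →
          (Comod.corestrict (π : H →ₗc[k] H') V).coinvariants = V.coinvariants,
        (Comod.corestrict (π : H →ₗc[k] H') (Comod.regular k H)).coinvariants =
          Submodule.span k {(1 : H)}]) :=
  ⟨(mainTheorem1_general k).1, fun H H' _ _ _ _ π => (mainTheorem1_general k).2 H H' π⟩
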